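/- Let $r\ge 1$ be an integer and let $\nu_1,\dots,\nu_r>-1$ be real. For $0\le j\le r-1$ let $w_j$ be the Meijer $G$-function \[ w_j(x)=G^{r,0}_{0,r}\left(\left.\begin{array}{c}-\\ \nu_r,\dots,\nu_2,\nu_1+j\end{array}\right|x\right)=\frac1{2\pi i}\int_{c-i\infty}^{c+i\infty}\Gamma(s+\nu_1+j)\prod_{k=2}^r\Gamma(s+\nu_k)\,x^{-s}\,ds ,\qquad x>0, \] where $c>-\min_k\nu_k$ (the value does not depend on the choice of such a $c$). For every integer $n\ge 0$ there is exactly one monic polynomial $P_n$ of degree $n$ with \[ \int_0^\infty P_n(x)\,x^k\,w_j(x)\,dx=0,\qquad 0\le k\le \Big\lceil \frac{n-j}{r}\Big\rceil-1,\quad 0\le j\le r-1, \] and these multiple orthogonal polynomials satisfy \[ \lim_{n\to\infty}(-1)^n\frac{P_n(z/n)}{\prod_{j=1}^r(\nu_j+1)_n}={}_0F_r(-;\nu_1+1,\dots,\nu_r+1;-z), \] uniformly on compact subsets of $\mathbb C$. Here $(a)_n=a(a+1)\cdots(a+n-1)$ and ${}_0F_r(-;b_1,\dots,b_r;z)=\sum_{k=0}^\infty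 \dfrac{z^k}{(b_1)_k\cdots(b_r)_k\,k!}$. -/

import Mathlib

namespace MehlerHeine

/-- The Meijer G-function `G^{r,0}_{0,r}( - ; b₁,…,b_r | x)`, given for `x > 0` by the
Mellin–Barnes integral `(1 / 2πi) ∫_{c - i∞}^{c + i∞} ∏ₖ Γ(s + bₖ) x^{-s} ds`.
The vertical line `Re s = c` has to lie to the right of all poles of the integrand, that is,
`-bₖ < c` for every `k`; the value does not depend on the choice of such a `c`. -/
noncomputable def meijerG {r : ℕ} (c : ℝ) (b : Fin r → ℝ) (x : ℝ) : ℂ :=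
  mellinInv c (fun s : ℂ => ∏ k, Complex.Gamma (s + (b k : ℂ))) x

/-- The weight `w_j`, `0 ≤ j ≤ r - 1`: the Meijer G-function with parameters
`ν_r, …, ν₂, ν₁ + j`.  The parameter `ν₁` is `ν 0`. -/
noncomputable def weight {r : ℕ} [NeZero r] (c : ℝ) (ν : Fin r → ℝ) (j : Fin r) (x : ℝ) : ℂ :=
  meijerG c (Function.update ν 0 (ν 0 + ((j : ℕ) : ℝ))) x

/-- `p` is a monic multiple orthogonal polynomial of degree `m` for the weights
`w_0, …, w_{r-1}`: for `0 ≤ j ≤ r - 1` it is orthogonal on `(0, ∞)` with respect to `w_j` to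
the powers `x ^ k` with `0 ≤ k ≤ ⌈(m - j) / r⌉ - 1`. -/
structure IsMultipleOrthogonal {r : ℕ} [NeZero r] (c : ℝ) (ν : Fin r → ℝ) (m : ℕ)
    (p : Polynomial ℂ) : Prop where
  monic : p.Monic
  natDegree_eq : p.natDegree = m
  orthogonal : ∀ (j : Fin r) (k : ℕ),
    (k : ℤ) ≤ ⌈((m : ℝ) - ((j : ℕ) : ℝ)) / (r : ℝ)⌉ - 1 →
      ∫ x in Set.Ioi (0 : ℝ), p.eval (x : ℂ) * (x : ℂ) ^ k * weight c ν j x = 0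

/-- The Pochhammer symbol `(a)_n = a (a + 1) ⋯ (a + n - 1)`. -/
noncomputable def poch (a : ℂ) (n : ℕ) : ℂ := (ascPochhammer ℂ n).eval a

/-- The generalized hypergeometric function
`₀F_r( - ; b₁,…,b_r; z) = ∑ₖ z ^ k / ((b₁)_k ⋯ (b_r)_k k!)`. -/
noncomputable def hypergeometric0F {r : ℕ} (b : Fin r → ℂ) (z : ℂ) : ℂ :=
  ∑' k : ℕ, z ^ k / ((∏ j, poch (b j) k) * (Nat.factorial k : ℂ))

end MehlerHeine

/-!
The Mellin transform of `w_j` at `s` is the product of Gamma functions in its Mellin–Barnes integral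
(`hasMellin_meijerG`). Mellin inversion gives this once some continuous function on `(0, ∞)` is known
to have that product as its Mellin transform; such a function is the iterated Mellin convolution of
the Gamma densities `u ^ b * e ^ (-u)` (`IsMellinKernel.gammaConv`). The convolution transforms
correctly on the whole half-plane to the right of the poles, so no contour has to be shifted,
although the moments are needed at the points `s = 1, 2, …` and the line of integration is
`Re s = c`.

Write `g(m) = ∏ₗ Γ(m + ν_l + 1)`. The moment `∫ x ^ (m + k) * w_j(x) dx` is then `g(m)` times a
monic polynomial in `m` of degree `k * r + j`. The orthogonality relations for degree `n` are indexed
by the pairs `(k, j)` with `k * r + j < n`, so each degree below `n` occurs exactly once, and for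
`p = ∑ₘ p_m x ^ m` they say that `∑ₘ p_m g(m) Q(m) = 0` for every polynomial `Q` of degree below `n`
(`isMultipleOrthogonal_iff`). With `p_m g(m)` proportional to `(-1) ^ m * (n choose m)` this sum is
an `n`-th forward difference, hence vanishes; that determines the monic solution
(`isMultipleOrthogonal_hypergeometricPoly`). The difference of two monic solutions has degree below
`n`, and testing it against Lagrange basis polynomials at the nodes `0, …, n - 1` shows that it is
zero (`isMultipleOrthogonal_unique`).

Rescaled as in the limit formula, the explicit solution is the series of the limit with the `m`-th
term multiplied by `n (n - 1) ⋯ (n - m + 1) / n ^ m`. This factor lies in `[0, 1]` and tends to `1`,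
so Tannery's theorem gives uniform convergence on discs.
-/

namespace MehlerHeine

open Complex MeasureTheory Set Filter Topology Polynomial

/-! ### The Gamma function on vertical lines -/

lemma norm_Gamma_le {s : ℂ} (hs : 0 < s.re) : ‖Gamma s‖ ≤ Real.Gamma s.re := by
  rw [Gamma_eq_integral hs, Real.Gamma_eq_integral hs, GammaIntegral]
  refine (norm_integral_le_integral_norm _).trans_eq (setIntegral_congr_fun measurableSet_Ioi ?_)
  intro x (hx : 0 < x)
  have h := norm_cpow_eq_rpow_re_of_pos hx (s - 1)
  simp only [sub_re, one_re] at h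
  simp only [norm_mul, h, norm_real, Real.norm_eq_abs, Real.abs_exp]

/-- Two steps of the functional equation turn the boundedness of `Γ` on vertical lines into
quadratic decay. -/
lemma norm_Gamma_le_div {s : ℂ} (hs : 0 < s.re) :
    ‖Gamma s‖ ≤ Real.Gamma (s.re + 2) / (s.re ^ 2 + s.im ^ 2) := by
  have hs0 : s ≠ 0 := fun h => by simp [h] at hs
  have hs1 : s + 1 ≠ 0 := fun h => by
    have := congrArg re h
    simp at this
    linarith
  have h1 : Gamma (s + 1 + 1) = (s + 1) * (s * Gamma s) := by
    rw [Gamma_add_one _ hs1, Gamma_add_one _ hs0]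
  have h2 : ‖Gamma (s + 1 + 1)‖ ≤ Real.Gamma (s.re + 2) := by
    have := norm_Gamma_le (s := s + 1 + 1) (by simp; linarith)
    simpa [add_assoc, one_add_one_eq_two] using this
  have h3 : ‖s‖ ≤ ‖s + 1‖ := by
    rw [Complex.norm_def, Complex.norm_def]
    apply Real.sqrt_le_sqrt
    simp [normSq_apply]
    nlinarith
  have h4 : s.re ^ 2 + s.im ^ 2 = ‖s‖ * ‖s‖ := by
    rw [Complex.norm_mul_self_eq_normSq, normSq_apply]; ring
  rw [h4, le_div_iff₀ (by positivity)]
  refine le_trans ?_ h2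
  rw [h1, norm_mul, norm_mul]
  calc ‖Gamma s‖ * (‖s‖ * ‖s‖) = ‖s‖ * (‖s‖ * ‖Gamma s‖) := by ring
    _ ≤ _ := by gcongr

lemma continuous_Gamma_vertical {σ : ℝ} (hσ : 0 < σ) :
    Continuous fun t : ℝ => Gamma (σ + t * I) := by
  rw [continuous_iff_continuousAt]
  intro t
  have h : ContinuousAt Gamma (σ + t * I) := by
    refine (differentiableAt_Gamma _ fun m h => ?_).continuousAt
    have := congrArg re h
    simp at this
    have := Nat.cast_nonneg (α := ℝ) m
    linarith
  exact h.comp (f := fun t : ℝ => (σ + t * I : ℂ)) (by fun_prop)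

lemma integrable_Gamma_vertical {σ : ℝ} (hσ : 0 < σ) :
    Integrable fun t : ℝ => Gamma (σ + t * I) := by
  have hG := Real.Gamma_pos_of_pos (show 0 < σ + 2 by linarith)
  refine (integrable_inv_one_add_sq.const_mul (Real.Gamma (σ + 2) * (1 + 1 / σ ^ 2))).mono'
    (continuous_Gamma_vertical hσ).aestronglyMeasurable (ae_of_all _ fun t => ?_)
  have h := norm_Gamma_le_div (s := σ + t * I) (by simpa using hσ)
  simp only [add_re, ofReal_re, mul_re, I_re, mul_zero, ofReal_im, I_im, mul_one, sub_self,
    add_zero, add_im, mul_im, zero_add] at h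
  refine h.trans ?_
  rw [mul_assoc, div_eq_mul_inv]
  gcongr
  rw [← div_eq_mul_inv, inv_eq_one_div, div_le_div_iff₀ (by positivity) (by positivity)]
  have : (1 + 1 / σ ^ 2) * (σ ^ 2 + t ^ 2) = 1 + t ^ 2 + σ ^ 2 + t ^ 2 / σ ^ 2 := by
    field_simp; ring
  rw [this]
  have : 0 ≤ t ^ 2 / σ ^ 2 := by positivity
  nlinarith [sq_nonneg σ]

lemma verticalIntegrable_prod_Gamma {r : ℕ} [NeZero r] {c : ℝ} {b : Fin r → ℝ}
    (hc : ∀ k, -b k < c) :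
    VerticalIntegrable (fun s : ℂ => ∏ k, Gamma (s + (b k : ℂ))) c := by
  have hshift (k : Fin r) (t : ℝ) : ((c : ℂ) + t * I) + (b k : ℂ) = ((c + b k : ℝ) : ℂ) + t * I := by
    push_cast; ring
  have hpos (k : Fin r) : 0 < c + b k := by linarith [hc k]
  unfold VerticalIntegrable
  simp only [hshift]
  have hsplit (t : ℝ) : ∏ k, Gamma (((c + b k : ℝ) : ℂ) + t * I)
      = (∏ k ∈ Finset.univ.erase 0, Gamma (((c + b k : ℝ) : ℂ) + t * I))
        * Gamma (((c + b 0 : ℝ) : ℂ) + t * I) := by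
    rw [Finset.prod_erase_mul _ _ (Finset.mem_univ _)]
  simp only [hsplit]
  refine (integrable_Gamma_vertical (hpos 0)).bdd_mul
    (c := ∏ k ∈ Finset.univ.erase 0, Real.Gamma (c + b k)) ?_ (ae_of_all _ fun t => ?_)
  · exact (continuous_finsetProd _ fun k _ =>
      continuous_Gamma_vertical (hpos k)).aestronglyMeasurable
  · rw [norm_prod]
    refine Finset.prod_le_prod (fun _ _ => norm_nonneg _) fun k _ => ?_
    simpa using norm_Gamma_le (s := ((c + b k : ℝ) : ℂ) + t * I) (by simpa using hpos k)

/-! ### Mellin convolution with a Gamma density -/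

/-- `W` is continuous on `(0, ∞)`, and on the half-plane `α < Re s` its Mellin transform converges
to `F s`. The bound on `x ^ σ * ‖W x‖` is what makes the class stable under Mellin convolution. -/
structure IsMellinKernel (α : ℝ) (F : ℂ → ℂ) (W : ℝ → ℂ) : Prop where
  continuousOn : ContinuousOn W (Ioi 0)
  bounded : ∀ σ : ℝ, α < σ → ∃ C : ℝ, ∀ x : ℝ, 0 < x → x ^ σ * ‖W x‖ ≤ C
  hasMellin : ∀ s : ℂ, α < s.re → HasMellin W s (F s)

/-- The unnormalized density `u ^ (β - 1) * e ^ (-u)` of the Gamma distribution. -/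
noncomputable def gammaDensity (β u : ℝ) : ℝ := u ^ (β - 1) * Real.exp (-u)

lemma gammaDensity_nonneg (β : ℝ) {u : ℝ} (hu : 0 < u) : 0 ≤ gammaDensity β u := by
  unfold gammaDensity; positivity

lemma continuousOn_gammaDensity (β : ℝ) : ContinuousOn (gammaDensity β) (Ioi 0) := by
  intro u (hu : 0 < u)
  unfold gammaDensity
  exact ((Real.continuousAt_rpow_const _ _ (Or.inl hu.ne')).mul
    (by fun_prop)).continuousWithinAt

lemma gammaDensity_mul_cpow {β u : ℝ} (hu : 0 < u) (s : ℂ) :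
    (gammaDensity β u : ℂ) * (u : ℂ) ^ s = (Real.exp (-u) : ℂ) * (u : ℂ) ^ (s + β - 1) := by
  have hu' : (u : ℂ) ≠ 0 := ofReal_ne_zero.2 hu.ne'
  rw [gammaDensity, ofReal_mul, ofReal_cpow hu.le, mul_right_comm, ← cpow_add _ _ hu', mul_comm]
  congr 2
  push_cast
  ring

lemma integrableOn_gammaDensity_mul_cpow {β : ℝ} {s : ℂ} (hs : -β < s.re) :
    IntegrableOn (fun u : ℝ => (gammaDensity β u : ℂ) * (u : ℂ) ^ s) (Ioi 0) := by
  have h := GammaIntegral_convergent (s := s + β) (by simp; linarith)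
  refine h.congr_fun (fun u hu => ?_) measurableSet_Ioi
  exact (gammaDensity_mul_cpow hu s).symm

lemma integral_gammaDensity_mul_cpow {β : ℝ} {s : ℂ} (hs : -β < s.re) :
    ∫ u in Ioi (0 : ℝ), (gammaDensity β u : ℂ) * (u : ℂ) ^ s = Gamma (s + β) := by
  rw [Gamma_eq_integral (by simp; linarith), GammaIntegral]
  exact setIntegral_congr_fun measurableSet_Ioi fun u hu => gammaDensity_mul_cpow hu s

lemma integrableOn_gammaDensity_mul_rpow {β σ : ℝ} (hσ : -β < σ) :
    IntegrableOn (fun u : ℝ => gammaDensity β u * u ^ σ) (Ioi 0) := by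
  have h := (integrableOn_gammaDensity_mul_cpow (β := β) (s := σ) (by simpa using hσ)).norm
  refine IntegrableOn.congr_fun h (fun u (hu : 0 < u) => ?_) measurableSet_Ioi
  simp only [norm_mul, norm_real, Real.norm_eq_abs, abs_of_nonneg (gammaDensity_nonneg β hu)]
  rw [norm_cpow_eq_rpow_re_of_pos hu, ofReal_re]

/-- The Mellin convolution of `W` with the Gamma density; on the Mellin side it is multiplication
by `Γ(s + β)`. -/
noncomputable def gammaConv (β : ℝ) (W : ℝ → ℂ) (x : ℝ) : ℂ :=
  ∫ u in Ioi (0 : ℝ), (gammaDensity β u : ℂ) * W (x / u)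

lemma rpow_mul_exp_neg_le {a x : ℝ} (ha : 0 < a) (hx : 0 < x) :
    x ^ a * Real.exp (-x) ≤ a ^ a := by
  -- `x / a ≤ e ^ (x / a)`, raised to the power `a`
  have h1 : x / a ≤ Real.exp (x / a) := by linarith [Real.add_one_le_exp (x / a)]
  have h2 : (x / a) ^ a ≤ Real.exp x := by
    refine (Real.rpow_le_rpow (by positivity) h1 ha.le).trans_eq ?_
    rw [← Real.exp_mul]
    congr 1
    field_simp
  rw [Real.div_rpow hx.le ha.le, div_le_iff₀ (by positivity)] at h2
  rw [Real.exp_neg, ← div_eq_mul_inv, div_le_iff₀ (Real.exp_pos _)]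
  linarith

lemma isMellinKernel_gammaDensity {α β : ℝ} (h : -β ≤ α) :
    IsMellinKernel α (fun s => Gamma (s + β)) (fun x => (gammaDensity (β + 1) x : ℂ)) where
  continuousOn := continuous_ofReal.comp_continuousOn (continuousOn_gammaDensity _)
  bounded σ hσ := by
    refine ⟨(σ + β) ^ (σ + β), fun x hx => ?_⟩
    rw [norm_real, Real.norm_eq_abs, abs_of_nonneg (gammaDensity_nonneg _ hx), gammaDensity,
      ← mul_assoc, ← Real.rpow_add hx, add_sub_cancel_right]
    exact rpow_mul_exp_neg_le (by linarith) hx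
  hasMellin s hs := by
    have hs' : -(β + 1) < (s - 1).re := by simp; linarith
    constructor
    · refine (integrableOn_gammaDensity_mul_cpow hs').congr_fun (fun u _ => ?_) measurableSet_Ioi
      simp [mul_comm]
    · have := integral_gammaDensity_mul_cpow hs'
      simp only [mellin, smul_eq_mul]
      simp only [mul_comm] at this ⊢
      rw [this]
      congr 1
      push_cast
      ring

section Convolution

variable {α β : ℝ} {F : ℂ → ℂ} {W : ℝ → ℂ}

lemma norm_gammaConv_integrand_le {σ C : ℝ} (hC : ∀ x : ℝ, 0 < x → x ^ σ * ‖W x‖ ≤ C)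
    {x u : ℝ} (hx : 0 < x) (hu : 0 < u) :
    ‖(gammaDensity β u : ℂ) * W (x / u)‖ ≤ x ^ (-σ) * C * (gammaDensity β u * u ^ σ) := by
  have h := hC (x / u) (div_pos hx hu)
  rw [Real.div_rpow hx.le hu.le, div_mul_eq_mul_div, div_le_iff₀ (by positivity)] at h
  rw [norm_mul, norm_real, Real.norm_eq_abs, abs_of_nonneg (gammaDensity_nonneg β hu),
    Real.rpow_neg hx.le]
  have h2 : ‖W (x / u)‖ ≤ (x ^ σ)⁻¹ * (C * u ^ σ) := by
    rw [inv_mul_eq_div, le_div_iff₀ (by positivity)]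
    linarith
  calc _ ≤ gammaDensity β u * ((x ^ σ)⁻¹ * (C * u ^ σ)) :=
        mul_le_mul_of_nonneg_left h2 (gammaDensity_nonneg β hu)
    _ = _ := by ring

lemma continuousOn_gammaConv_integrand (hW : ContinuousOn W (Ioi 0)) :
    ContinuousOn (fun p : ℝ × ℝ => (gammaDensity β p.2 : ℂ) * W (p.1 / p.2))
      (Ioi 0 ×ˢ Ioi 0) := by
  refine ContinuousOn.mul (continuous_ofReal.comp_continuousOn
    ((continuousOn_gammaDensity β).comp continuousOn_snd fun p hp => hp.2)) ?_
  exact hW.comp (continuousOn_fst.div continuousOn_snd fun p hp => (ne_of_gt hp.2))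
    fun p hp => mem_Ioi.2 (div_pos (mem_Ioi.1 hp.1) (mem_Ioi.1 hp.2))

lemma aestronglyMeasurable_gammaConv_integrand (hW : ContinuousOn W (Ioi 0)) {x : ℝ}
    (hx : 0 < x) :
    AEStronglyMeasurable (fun u : ℝ => (gammaDensity β u : ℂ) * W (x / u))
      (volume.restrict (Ioi 0)) := by
  refine ContinuousOn.aestronglyMeasurable ?_ measurableSet_Ioi
  exact (continuousOn_gammaConv_integrand hW).comp (f := fun u : ℝ => (x, u)) (by fun_prop)
    fun u hu => ⟨hx, hu⟩

lemma IsMellinKernel.continuousOn_gammaConv (hW : IsMellinKernel α F W) (h : -β ≤ α) :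
    ContinuousOn (gammaConv β W) (Ioi 0) := by
  intro x₀ (hx₀ : 0 < x₀)
  refine ContinuousAt.continuousWithinAt ?_
  obtain ⟨C, hC⟩ := hW.bounded (α + 1) (by linarith)
  have hC0 : 0 ≤ C := le_trans (by positivity) (hC 1 one_pos)
  have hev : ∀ᶠ x : ℝ in 𝓝 x₀, 0 < x ∧ x ^ (-(α + 1)) < x₀ ^ (-(α + 1)) + 1 :=
    (lt_mem_nhds hx₀).and ((Real.continuousAt_rpow_const _ _ (Or.inl hx₀.ne')).eventually_lt
      continuousAt_const (lt_add_one _))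
  refine continuousAt_of_dominated
    (bound := fun u => (x₀ ^ (-(α + 1)) + 1) * C * (gammaDensity β u * u ^ (α + 1))) ?_ ?_ ?_ ?_
  · filter_upwards [hev] with x hx
    exact aestronglyMeasurable_gammaConv_integrand hW.continuousOn hx.1
  · filter_upwards [hev] with x hx
    filter_upwards [ae_restrict_mem measurableSet_Ioi] with u hu
    have hu' : 0 < u := hu
    refine (norm_gammaConv_integrand_le hC hx.1 hu').trans ?_
    have := gammaDensity_nonneg β hu'
    have := hx.2.le
    gcongr
  · exact (integrableOn_gammaDensity_mul_rpow (by linarith)).const_mul _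
  · filter_upwards [ae_restrict_mem measurableSet_Ioi] with u hu
    have hu' : 0 < u := hu
    refine continuousAt_const.mul ?_
    exact (hW.continuousOn.continuousAt (Ioi_mem_nhds (div_pos hx₀ hu'))).comp
      (f := fun x : ℝ => x / u) (by fun_prop)

lemma IsMellinKernel.bounded_gammaConv (hW : IsMellinKernel α F W) (h : -β ≤ α) {σ : ℝ}
    (hσ : α < σ) : ∃ C : ℝ, ∀ x : ℝ, 0 < x → x ^ σ * ‖gammaConv β W x‖ ≤ C := by
  obtain ⟨C, hC⟩ := hW.bounded σ hσ
  refine ⟨C * ∫ u in Ioi (0 : ℝ), gammaDensity β u * u ^ σ, fun x hx => ?_⟩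
  have h1 : ‖gammaConv β W x‖
      ≤ ∫ u in Ioi (0 : ℝ), x ^ (-σ) * C * (gammaDensity β u * u ^ σ) := by
    refine norm_integral_le_of_norm_le
      ((integrableOn_gammaDensity_mul_rpow (by linarith)).const_mul _) ?_
    filter_upwards [ae_restrict_mem measurableSet_Ioi] with u hu
    exact norm_gammaConv_integrand_le hC hx hu
  rw [integral_const_mul] at h1
  calc x ^ σ * ‖gammaConv β W x‖ ≤ x ^ σ * (x ^ (-σ) * C *
        ∫ u in Ioi (0 : ℝ), gammaDensity β u * u ^ σ) := by gcongr
    _ = (x ^ σ * x ^ (-σ)) * (C * ∫ u in Ioi (0 : ℝ), gammaDensity β u * u ^ σ) := by ring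
    _ = _ := by rw [← Real.rpow_add hx]; simp

/-- The substitution `x = u * y` that factors the Mellin transform of a convolution. -/
lemma mellin_gammaConv_integrand_eq {x u : ℝ} (hx : 0 < x) (hu : 0 < u) (s : ℂ) :
    (x : ℂ) ^ (s - 1) * ((gammaDensity β u : ℂ) * W (x / u))
      = ((gammaDensity β u : ℂ) * (u : ℂ) ^ (s - 1))
        * (((u⁻¹ * x : ℝ) : ℂ) ^ (s - 1) * W (u⁻¹ * x)) := by
  have h : (x : ℂ) ^ (s - 1) = (u : ℂ) ^ (s - 1) * ((u⁻¹ * x : ℝ) : ℂ) ^ (s - 1) := by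
    rw [← mul_cpow_ofReal_nonneg hu.le (by positivity), ← ofReal_mul, mul_inv_cancel_left₀ hu.ne']
  rw [h, div_eq_inv_mul]
  ring

lemma cpow_sub_one_mul_self {u : ℝ} (hu : 0 < u) (s : ℂ) :
    (u : ℂ) ^ (s - 1) * (u : ℂ) = (u : ℂ) ^ s := by
  have hu' : (u : ℂ) ≠ 0 := ofReal_ne_zero.2 hu.ne'
  rw [cpow_sub _ _ hu', cpow_one, div_mul_cancel₀ _ hu']

lemma IsMellinKernel.hasMellin_gammaConv (hW : IsMellinKernel α F W) (h : -β ≤ α) {s : ℂ}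
    (hs : α < s.re) : HasMellin (gammaConv β W) s (Gamma (s + β) * F s) := by
  set H : ℝ → ℂ := fun y => (y : ℂ) ^ (s - 1) * W y with hH
  have hHint : IntegrableOn H (Ioi 0) := (hW.hasMellin s hs).1
  have hHval : ∫ y in Ioi (0 : ℝ), H y = F s := (hW.hasMellin s hs).2
  set f : ℝ → ℝ → ℂ := fun x u => (x : ℂ) ^ (s - 1) * ((gammaDensity β u : ℂ) * W (x / u))
    with hf
  set g : ℝ → ℂ := fun u => (gammaDensity β u : ℂ) * (u : ℂ) ^ (s - 1) with hg
  have hfeq {x u : ℝ} (hx : 0 < x) (hu : 0 < u) : f x u = g u * H (u⁻¹ * x) :=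
    mellin_gammaConv_integrand_eq hx hu s
  have hgu {u : ℝ} (hu : 0 < u) : g u * (u : ℂ) = (gammaDensity β u : ℂ) * (u : ℂ) ^ s := by
    rw [hg, mul_assoc, cpow_sub_one_mul_self hu]
  have hmeas : AEStronglyMeasurable (Function.uncurry f)
      ((volume.restrict (Ioi 0)).prod (volume.restrict (Ioi 0))) := by
    rw [Measure.prod_restrict]
    refine ContinuousOn.aestronglyMeasurable ?_ (measurableSet_Ioi.prod measurableSet_Ioi)
    refine ContinuousOn.mul ?_ (continuousOn_gammaConv_integrand hW.continuousOn)
    intro p hp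
    refine ContinuousAt.continuousWithinAt ?_
    exact (continuousAt_ofReal_cpow_const _ _ (Or.inr (ne_of_gt hp.1))).comp continuousAt_fst
  have hint : Integrable (Function.uncurry f)
      ((volume.restrict (Ioi 0)).prod (volume.restrict (Ioi 0))) := by
    rw [integrable_prod_iff' hmeas]
    constructor
    · filter_upwards [ae_restrict_mem measurableSet_Ioi] with u hu
      have hu' : 0 < u := hu
      have h1 : IntegrableOn (fun x => H (u⁻¹ * x)) (Ioi 0) := by
        rw [integrableOn_Ioi_comp_mul_left_iff _ _ (inv_pos.2 hu'), mul_zero]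
        exact hHint
      exact IntegrableOn.congr_fun (h1.const_mul (g u)) (fun x hx => (hfeq hx hu').symm)
        measurableSet_Ioi
    · have h1 : IntegrableOn (fun u : ℝ => ‖(gammaDensity β u : ℂ) * (u : ℂ) ^ s‖
          * ∫ y in Ioi (0 : ℝ), ‖H y‖) (Ioi 0) :=
        (integrableOn_gammaDensity_mul_cpow (by linarith)).norm.mul_const _
      refine IntegrableOn.congr_fun h1 (fun u (hu : 0 < u) => ?_) measurableSet_Ioi
      have h2 : ∫ x in Ioi (0 : ℝ), ‖f x u‖ = ∫ x in Ioi (0 : ℝ), ‖g u‖ * ‖H (u⁻¹ * x)‖ :=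
        setIntegral_congr_fun measurableSet_Ioi fun x hx => by
          simp only [hfeq hx hu, norm_mul]
      simp only [Function.uncurry_apply_pair]
      rw [h2, integral_const_mul, integral_comp_mul_left_Ioi (fun y => ‖H y‖) 0 (inv_pos.2 hu),
        mul_zero, inv_inv, ← hgu hu, norm_mul, norm_real, Real.norm_of_nonneg hu.le, smul_eq_mul,
        mul_assoc]
  have hconv (x : ℝ) : (x : ℂ) ^ (s - 1) • gammaConv β W x = ∫ u in Ioi (0 : ℝ), f x u := by
    rw [hf, integral_const_mul, gammaConv, smul_eq_mul]
  refine ⟨?_, ?_⟩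
  · simp only [MellinConvergent, hconv]
    exact hint.integral_prod_left
  · simp only [mellin, hconv]
    rw [integral_integral_swap hint, ← integral_gammaDensity_mul_cpow (by linarith),
      ← integral_mul_const]
    refine setIntegral_congr_fun measurableSet_Ioi fun u (hu : 0 < u) => ?_
    have h2 : ∫ x in Ioi (0 : ℝ), f x u = ∫ x in Ioi (0 : ℝ), g u * H (u⁻¹ * x) :=
      setIntegral_congr_fun measurableSet_Ioi fun x hx => hfeq hx hu
    rw [h2, integral_const_mul, integral_comp_mul_left_Ioi H 0 (inv_pos.2 hu), mul_zero, inv_inv,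
      hHval, ← hgu hu, real_smul, ← mul_assoc]

lemma IsMellinKernel.gammaConv (hW : IsMellinKernel α F W) (h : -β ≤ α) :
    IsMellinKernel α (fun s => Gamma (s + β) * F s) (gammaConv β W) :=
  ⟨hW.continuousOn_gammaConv h, fun _ => hW.bounded_gammaConv h, fun _ => hW.hasMellin_gammaConv h⟩

end Convolution

lemma exists_isMellinKernel_prod_Gamma (α : ℝ) (m : ℕ) (b : Fin (m + 1) → ℝ)
    (h : ∀ k, -b k ≤ α) :
    ∃ W, IsMellinKernel α (fun s => ∏ k, Gamma (s + (b k : ℂ))) W := by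
  induction m with
  | zero =>
    exact ⟨_, by simpa using isMellinKernel_gammaDensity (h 0)⟩
  | succ m ih =>
    obtain ⟨W, hW⟩ := ih (fun k => b k.succ) fun k => h k.succ
    exact ⟨_, by simpa only [Fin.prod_univ_succ (n := m + 1)] using hW.gammaConv (h 0)⟩

/-! ### The Mellin transform of the Meijer G-function -/

/-- The Mellin transform of the Meijer G-function is the product of Gamma functions it was built
from, also at points `s` off the line of integration. -/
lemma hasMellin_meijerG {r : ℕ} [NeZero r] {c : ℝ} {b : Fin r → ℝ} (hc : ∀ k, -b k < c) {s : ℂ}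
    (hs : ∀ k, -b k < s.re) :
    HasMellin (meijerG c b) s (∏ k, Gamma (s + (b k : ℂ))) := by
  obtain ⟨m, rfl⟩ := Nat.exists_eq_succ_of_ne_zero (NeZero.ne r)
  -- `α` is the abscissa of the rightmost pole, so both `c` and `s` lie to the right of it
  set α := Finset.univ.sup' Finset.univ_nonempty fun k => -b k with hα
  have hαc : α < c := by rw [hα, Finset.sup'_lt_iff]; exact fun k _ => hc k
  have hαs : α < s.re := by rw [hα, Finset.sup'_lt_iff]; exact fun k _ => hs k
  obtain ⟨W, hW⟩ := exists_isMellinKernel_prod_Gamma α m b fun k =>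
    Finset.le_sup' (fun k => -b k) (Finset.mem_univ k)
  have hG : EqOn W (meijerG c b) (Ioi 0) := by
    intro x (hx : 0 < x)
    have hline (y : ℝ) : mellin W (c + y * I) = ∏ k, Gamma ((c + y * I) + (b k : ℂ)) :=
      (hW.hasMellin _ (by simpa using hαc)).2
    have h := mellinInv_mellin_eq c W hx (hW.hasMellin c (by simpa using hαc)).1
      (by simpa only [VerticalIntegrable, hline] using verticalIntegrable_prod_Gamma hc)
      (hW.continuousOn.continuousAt (Ioi_mem_nhds hx))
    rw [← h]
    simp only [meijerG, mellinInv, hline]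
  obtain ⟨h1, h2⟩ := hW.hasMellin s hαs
  refine ⟨h1.congr_fun (fun x hx => ?_) measurableSet_Ioi, ?_⟩
  · simp only [hG hx]
  · rw [← h2]
    refine setIntegral_congr_fun measurableSet_Ioi fun x hx => ?_
    simp only [hG hx]

/-! ### Products of Gamma values and Pochhammer symbols -/

lemma Gamma_add_natCast {z : ℂ} (hz : 0 < z.re) (n : ℕ) :
    Gamma (z + n) = poch z n * Gamma z := by
  have h : ∀ k : ℕ, z ≠ -k := fun k hk => by
    have := congrArg re hk
    simp at this
    have := Nat.cast_nonneg (α := ℝ) k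
    linarith
  rw [poch, ← Gamma_add_nat_div_Gamma_eq z h, div_mul_cancel₀ _ (Gamma_ne_zero_of_re_pos hz)]

section

variable {r : ℕ} (ν : Fin r → ℝ)

/-- The `m`-th moment `∏ₗ Γ(m + ν_l + 1)` of the weight `w_0`. -/
noncomputable def gammaMoment (m : ℕ) : ℂ := ∏ l, Gamma ((ν l : ℂ) + 1 + m)

variable {ν}

lemma re_add_one_pos (hν : ∀ l, -1 < ν l) (l : Fin r) (m : ℕ) : 0 < ((ν l : ℂ) + 1 + m).re := by
  have := hν l
  have := Nat.cast_nonneg (α := ℝ) m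
  simp
  linarith

lemma gammaMoment_ne_zero (hν : ∀ l, -1 < ν l) (m : ℕ) : gammaMoment ν m ≠ 0 :=
  Finset.prod_ne_zero_iff.2 fun l _ => Gamma_ne_zero_of_re_pos (re_add_one_pos hν l m)

lemma gammaMoment_add (hν : ∀ l, -1 < ν l) (m k : ℕ) :
    gammaMoment ν (m + k) = (∏ l, poch ((ν l : ℂ) + 1 + m) k) * gammaMoment ν m := by
  rw [gammaMoment, gammaMoment, ← Finset.prod_mul_distrib]
  refine Finset.prod_congr rfl fun l _ => ?_
  rw [← Gamma_add_natCast (re_add_one_pos hν l m)]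
  push_cast
  ring_nf

lemma gammaMoment_eq (hν : ∀ l, -1 < ν l) (m : ℕ) :
    gammaMoment ν m = (∏ l, poch ((ν l : ℂ) + 1) m) * gammaMoment ν 0 := by
  simpa using gammaMoment_add hν 0 m

/-! ### The coefficient functional and the hypergeometric polynomials -/

/-- The functional `Q ↦ ∑ₘ p_m g(m) Q(m)`, where `p_m` are the coefficients of `p` and `g(m)` is
`gammaMoment ν m`. -/
noncomputable def coeffPairing (ν : Fin r → ℝ) (n : ℕ) (p : ℂ[X]) : ℂ[X] →ₗ[ℂ] ℂ :=
  ∑ m ∈ Finset.range (n + 1), (p.coeff m * gammaMoment ν m) • Polynomial.leval (m : ℂ)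

lemma coeffPairing_apply (n : ℕ) (p Q : ℂ[X]) :
    coeffPairing ν n p Q
      = ∑ m ∈ Finset.range (n + 1), p.coeff m * gammaMoment ν m * Q.eval (m : ℂ) := by
  simp [coeffPairing, Polynomial.leval]

/-- The multiple orthogonal polynomial of degree `n`,
`∑ₘ (-1) ^ (n + m) * (n choose m) * (g(n) / g(m)) * x ^ m` with `g = gammaMoment ν`; up to its
normalization it is the hypergeometric polynomial `₁F_r(-n; ν₁ + 1, …, ν_r + 1; x)`. -/
noncomputable def hypergeometricPoly (ν : Fin r → ℝ) (n : ℕ) : ℂ[X] :=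
  ∑ m ∈ Finset.range (n + 1),
    C ((-1) ^ (n + m) * (n.choose m : ℂ) * (gammaMoment ν n / gammaMoment ν m)) * X ^ m

lemma coeff_hypergeometricPoly (n m : ℕ) :
    (hypergeometricPoly ν n).coeff m
      = (-1) ^ (n + m) * (n.choose m : ℂ) * (gammaMoment ν n / gammaMoment ν m) := by
  simp only [hypergeometricPoly, finsetSum_coeff, coeff_C_mul_X_pow]
  rw [Finset.sum_ite_eq]
  split_ifs with h
  · rfl
  · rw [Nat.choose_eq_zero_of_lt (by simpa using h)]
    simp

lemma coeff_hypergeometricPoly_self (hν : ∀ l, -1 < ν l) (n : ℕ) :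
    (hypergeometricPoly ν n).coeff n = 1 := by
  rw [coeff_hypergeometricPoly, div_self (gammaMoment_ne_zero hν n), ← two_mul, pow_mul]
  simp

lemma natDegree_hypergeometricPoly (hν : ∀ l, -1 < ν l) (n : ℕ) :
    (hypergeometricPoly ν n).natDegree = n := by
  refine natDegree_eq_of_le_of_coeff_ne_zero ?_ (by rw [coeff_hypergeometricPoly_self hν]; simp)
  rw [natDegree_le_iff_coeff_eq_zero]
  intro m hm
  rw [coeff_hypergeometricPoly, Nat.choose_eq_zero_of_lt hm]
  simp

end

section

variable {r : ℕ} [NeZero r] {ν : Fin r → ℝ} {c : ℝ}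

/-! ### Power moments of `w_j` -/

lemma neg_update_lt {σ : ℝ} (hσ : ∀ l, -ν l < σ) (j : Fin r) (l : Fin r) :
    -(Function.update ν 0 (ν 0 + ((j : ℕ) : ℝ))) l < σ := by
  have := Nat.cast_nonneg (α := ℝ) (j : ℕ)
  rcases eq_or_ne l 0 with rfl | h
  · simp only [Function.update_self]
    linarith [hσ 0]
  · simpa [Function.update_of_ne h] using hσ l

lemma prod_Gamma_update (hν : ∀ l, -1 < ν l) (j : Fin r) (m : ℕ) :
    ∏ l, Gamma (((m + 1 : ℕ) : ℂ)
        + ((Function.update ν 0 (ν 0 + ((j : ℕ) : ℝ)) l : ℝ) : ℂ))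
      = poch ((ν 0 : ℂ) + 1 + m) j * gammaMoment ν m := by
  rw [gammaMoment, ← Finset.mul_prod_erase _ _ (Finset.mem_univ 0),
    ← Finset.mul_prod_erase Finset.univ (fun l => Gamma ((ν l : ℂ) + 1 + m)) (Finset.mem_univ 0),
    ← mul_assoc, ← Gamma_add_natCast (re_add_one_pos hν 0 m)]
  congr 1
  · simp only [Function.update_self]
    push_cast
    ring_nf
  · refine Finset.prod_congr rfl fun l hl => ?_
    rw [Function.update_of_ne (Finset.ne_of_mem_erase hl)]
    push_cast
    ring_nf

lemma integrableOn_pow_mul_weight (hν : ∀ l, -1 < ν l) (hc : ∀ l, -ν l < c) (j : Fin r) (m : ℕ) :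
    IntegrableOn (fun x : ℝ => (x : ℂ) ^ m * weight c ν j x) (Ioi 0) ∧
      ∫ x in Ioi (0 : ℝ), (x : ℂ) ^ m * weight c ν j x
        = poch ((ν 0 : ℂ) + 1 + m) j * gammaMoment ν m := by
  have hσ : ∀ l, -ν l < (((m + 1 : ℕ) : ℂ)).re := fun l => by
    have := hν l
    have := Nat.cast_nonneg (α := ℝ) m
    simp
    linarith
  obtain ⟨h1, h2⟩ := hasMellin_meijerG (neg_update_lt hc j) (neg_update_lt hσ j)
  rw [prod_Gamma_update hν] at h2
  simp only [MellinConvergent, mellin, Nat.cast_add, Nat.cast_one, add_sub_cancel_right,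
    cpow_natCast, smul_eq_mul] at h1 h2
  exact ⟨h1, h2⟩

/-! ### The orthogonality relations as conditions on coefficients -/

/-- The polynomial in `m` whose value is the ratio of the moment
`∫ x ^ (m + i / r) * w_{i % r}(x) dx` to `gammaMoment ν m`; division with remainder by `r`
encodes the pairs `(k, j)` as `i = k * r + j`. -/
noncomputable def momentPoly (ν : Fin r → ℝ) (i : ℕ) : ℂ[X] :=
  (ascPochhammer ℂ (i % r)).comp (X + C ((ν 0 : ℂ) + 1 + (i / r : ℕ)))
    * ∏ l, (ascPochhammer ℂ (i / r)).comp (X + C ((ν l : ℂ) + 1))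

lemma monic_momentPoly (i : ℕ) : (momentPoly ν i).Monic :=
  ((monic_ascPochhammer ℂ _).comp_X_add_C _).mul
    (monic_prod_of_monic _ _ fun _ _ => (monic_ascPochhammer ℂ _).comp_X_add_C _)

lemma natDegree_momentPoly (i : ℕ) : (momentPoly ν i).natDegree = i := by
  rw [momentPoly, Monic.natDegree_mul ((monic_ascPochhammer ℂ _).comp_X_add_C _)
    (monic_prod_of_monic _ _ fun _ _ => (monic_ascPochhammer ℂ _).comp_X_add_C _),
    natDegree_prod_of_monic _ _ fun _ _ => (monic_ascPochhammer ℂ _).comp_X_add_C _]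
  simp only [natDegree_comp, ascPochhammer_natDegree, natDegree_X_add_C, mul_one,
    Finset.sum_const, Finset.card_univ, Fintype.card_fin, smul_eq_mul, Nat.mod_add_div]

/-- `momentPoly` as a sequence with one polynomial in each degree. -/
noncomputable def momentSequence (ν : Fin r → ℝ) : Polynomial.Sequence ℂ where
  elems' := momentPoly ν
  degree_eq' i := by
    rw [degree_eq_natDegree (monic_momentPoly i).ne_zero, natDegree_momentPoly]

lemma integral_mul_weight (hν : ∀ l, -1 < ν l) (hc : ∀ l, -ν l < c) {n : ℕ} {p : ℂ[X]}
    (hp : p.natDegree ≤ n) (j : Fin r) (k : ℕ) :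
    ∫ x in Ioi (0 : ℝ), p.eval (x : ℂ) * (x : ℂ) ^ k * weight c ν j x
      = coeffPairing ν n p (momentPoly ν (j + k * r)) := by
  have hsum (x : ℝ) : p.eval (x : ℂ) * (x : ℂ) ^ k * weight c ν j x
      = ∑ m ∈ Finset.range (n + 1), p.coeff m * ((x : ℂ) ^ (m + k) * weight c ν j x) := by
    rw [eval_eq_sum_range' (Nat.lt_succ_of_le hp), Finset.sum_mul, Finset.sum_mul]
    exact Finset.sum_congr rfl fun m _ => by ring
  simp only [hsum]
  rw [integral_finsetSum _ fun m _ => ((integrableOn_pow_mul_weight hν hc j (m + k)).1).const_mul _,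
    coeffPairing_apply]
  refine Finset.sum_congr rfl fun m _ => ?_
  have hmod : ((j : ℕ) + k * r) % r = j := by
    rw [Nat.add_mul_mod_self_right, Nat.mod_eq_of_lt j.2]
  have hdiv : ((j : ℕ) + k * r) / r = k := by
    rw [Nat.add_mul_div_right _ _ (NeZero.pos r), Nat.div_eq_of_lt j.2, zero_add]
  rw [integral_const_mul, (integrableOn_pow_mul_weight hν hc j (m + k)).2, gammaMoment_add hν,
    momentPoly, hmod, hdiv, eval_mul, eval_prod]
  simp only [eval_comp, eval_add, eval_X, eval_C, poch]
  push_cast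
  have h1 : (m : ℂ) + ((ν 0 : ℂ) + 1 + k) = (ν 0 : ℂ) + 1 + (m + k) := by ring
  simp only [h1, add_comm (m : ℂ) ((ν _ : ℂ) + 1)]
  ring

lemma le_ceil_sub_one_iff (n j k : ℕ) :
    (k : ℤ) ≤ ⌈((n : ℝ) - (j : ℝ)) / (r : ℝ)⌉ - 1 ↔ j + k * r < n := by
  have hr : (0 : ℝ) < r := Nat.cast_pos.2 (NeZero.pos r)
  rw [Int.le_sub_one_iff, Int.lt_ceil, lt_div_iff₀ hr, lt_sub_iff_add_lt', Int.cast_natCast]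
  exact_mod_cast Iff.rfl

/-- The orthogonality relations involve one `momentPoly` of each degree below `n`, hence say that
the functional of `p` annihilates all polynomials of degree below `n`. -/
lemma isMultipleOrthogonal_iff (hν : ∀ l, -1 < ν l) (hc : ∀ l, -ν l < c) (n : ℕ) (p : ℂ[X]) :
    IsMultipleOrthogonal c ν n p ↔ p.Monic ∧ p.natDegree = n ∧
      ∀ Q ∈ degreeLT ℂ n, coeffPairing ν n p Q = 0 := by
  constructor
  · rintro ⟨h1, h2, h3⟩
    refine ⟨h1, h2, fun Q hQ => ?_⟩
    rw [← (momentSequence ν).span_degreeLT fun i _ =>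
      (monic_momentPoly (ν := ν) i).leadingCoeff ▸ isUnit_one] at hQ
    refine (Submodule.span_le (p := LinearMap.ker (coeffPairing ν n p))).2 ?_ hQ
    rintro _ ⟨i, hi, rfl⟩
    have hi' : i % r + i / r * r < n := by
      rw [mul_comm, Nat.mod_add_div]; exact hi
    have h := h3 ⟨i % r, Nat.mod_lt _ (NeZero.pos r)⟩ (i / r) ((le_ceil_sub_one_iff _ _ _).2 hi')
    rw [integral_mul_weight hν hc h2.le] at h
    simp only [mul_comm (i / r) r, Nat.mod_add_div] at h
    exact h
  · rintro ⟨h1, h2, h3⟩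
    refine ⟨h1, h2, fun j k hk => ?_⟩
    rw [integral_mul_weight hν hc h2.le]
    refine h3 _ ?_
    rw [mem_degreeLT, degree_eq_natDegree (monic_momentPoly _).ne_zero, natDegree_momentPoly]
    exact_mod_cast (le_ceil_sub_one_iff _ _ _).1 hk

/-! ### Existence and uniqueness -/

lemma isMultipleOrthogonal_unique (hν : ∀ l, -1 < ν l) (hc : ∀ l, -ν l < c) {n : ℕ} {p q : ℂ[X]}
    (hp : IsMultipleOrthogonal c ν n p) (hq : IsMultipleOrthogonal c ν n q) : p = q := by
  obtain ⟨hp1, hp2, hp3⟩ := (isMultipleOrthogonal_iff hν hc n p).1 hp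
  obtain ⟨hq1, hq2, hq3⟩ := (isMultipleOrthogonal_iff hν hc n q).1 hq
  have htop : p.coeff n = q.coeff n := by
    have h1 := hp1.coeff_natDegree
    have h2 := hq1.coeff_natDegree
    rw [hp2] at h1
    rw [hq2] at h2
    rw [h1, h2]
  ext i
  rcases lt_trichotomy i n with hi | rfl | hi
  · -- the functional of `p - q` sees only the nodes `0, …, n - 1`; test it on a Lagrange basis
    have hinj : Set.InjOn (fun m : ℕ => (m : ℂ)) (Finset.range n : Set ℕ) :=
      Nat.cast_injective.injOn
    have hmem : i ∈ Finset.range n := Finset.mem_range.2 hi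
    set Q := Lagrange.basis (Finset.range n) (fun m : ℕ => (m : ℂ)) i with hQ
    have hdeg : Q ∈ degreeLT ℂ n := by
      rw [mem_degreeLT, hQ, Lagrange.degree_basis hinj hmem, Finset.card_range]
      exact_mod_cast Nat.sub_lt (by omega) one_pos
    have hval (f : ℂ[X]) : coeffPairing ν n f Q
        = f.coeff i * gammaMoment ν i + f.coeff n * gammaMoment ν n * Q.eval (n : ℂ) := by
      rw [coeffPairing_apply, Finset.sum_range_succ, Finset.sum_eq_single i]
      · rw [hQ, Lagrange.eval_basis_self hinj hmem, mul_one]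
      · intro m hm hmi
        rw [hQ, Lagrange.eval_basis_of_ne hmi.symm hm, mul_zero]
      · exact fun h => absurd hmem h
    have h := (hval p).symm.trans ((hp3 Q hdeg).trans ((hq3 Q hdeg).symm.trans (hval q)))
    rw [htop] at h
    exact mul_right_cancel₀ (gammaMoment_ne_zero hν i) (add_right_cancel h)
  · exact htop
  · rw [coeff_eq_zero_of_natDegree_lt (by omega), coeff_eq_zero_of_natDegree_lt (by omega)]

/-- The functional of `hypergeometricPoly ν n` is a multiple of the `n`-th forward difference,
which annihilates all polynomials of degree below `n`. -/
lemma isMultipleOrthogonal_hypergeometricPoly (hν : ∀ l, -1 < ν l) (hc : ∀ l, -ν l < c) (n : ℕ) :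
    IsMultipleOrthogonal c ν n (hypergeometricPoly ν n) := by
  rw [isMultipleOrthogonal_iff hν hc]
  refine ⟨?_, natDegree_hypergeometricPoly hν n, fun Q hQ => ?_⟩
  · rw [Monic, leadingCoeff, natDegree_hypergeometricPoly hν, coeff_hypergeometricPoly_self hν]
  rcases eq_or_ne Q 0 with rfl | hQ0
  · exact map_zero _
  have hdeg : Q.natDegree < n := by
    rwa [mem_degreeLT, degree_eq_natDegree hQ0, Nat.cast_lt] at hQ
  have hdiff := congrFun (Polynomial.fwdDiff_iter_eq_zero_of_degree_lt hdeg) 0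
  rw [fwdDiff_iter_eq_sum_shift] at hdiff
  simp only [Pi.zero_apply, zero_add, nsmul_eq_mul, mul_one, zsmul_eq_mul] at hdiff
  rw [coeffPairing_apply, ← mul_zero (gammaMoment ν n), ← hdiff, Finset.mul_sum]
  refine Finset.sum_congr rfl fun m hm => ?_
  have hm' : m ≤ n := Nat.lt_succ_iff.1 (Finset.mem_range.1 hm)
  have hsign : (-1 : ℂ) ^ (n + m) = (-1) ^ (n - m) := by
    rw [show n + m = (n - m) + 2 * m by omega, pow_add, pow_mul]
    simp
  rw [coeff_hypergeometricPoly, hsign]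
  have := gammaMoment_ne_zero hν m
  push_cast
  field_simp

end

/-! ### The scaling limit -/

lemma min_one_le_norm_poch {a : ℝ} (ha : 0 < a) (m : ℕ) : min a 1 ≤ ‖poch (a : ℂ) m‖ := by
  induction m with
  | zero => simp [poch]
  | succ m ih =>
    have h : ‖poch (a : ℂ) (m + 1)‖ = ‖poch (a : ℂ) m‖ * (a + m) := by
      rw [poch, ascPochhammer_succ_eval, norm_mul]
      congr 1
      rw [← ofReal_natCast, ← ofReal_add, norm_real, Real.norm_of_nonneg (by positivity)]
    rw [h]
    rcases Nat.eq_zero_or_pos m with rfl | hm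
    · simp [poch]
    · have h1 : (1 : ℝ) ≤ m := Nat.one_le_cast.2 hm
      exact ih.trans (le_mul_of_one_le_right (norm_nonneg _) (by linarith))

section

variable {r : ℕ} (ν : Fin r → ℝ)

/-- The coefficients of the series `₀F_r(-; ν₁ + 1, …, ν_r + 1; z)`. -/
noncomputable def hypergeometricCoeff (m : ℕ) : ℂ :=
  ((∏ j, poch ((ν j : ℂ) + 1) m) * (m.factorial : ℂ))⁻¹

variable {ν}

lemma summable_norm_hypergeometricCoeff (hν : ∀ l, -1 < ν l) (R : ℝ) :
    Summable fun m : ℕ => ‖hypergeometricCoeff ν m‖ * |R| ^ m := by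
  have hpos (l : Fin r) : 0 < ν l + 1 := by linarith [hν l]
  have hC : 0 < ∏ l, min (ν l + 1) 1 :=
    Finset.prod_pos fun l _ => lt_min (hpos l) one_pos
  refine Summable.of_nonneg_of_le (fun m => by positivity) (fun m => ?_)
    ((Real.summable_pow_div_factorial |R|).mul_left (∏ l, min (ν l + 1) 1)⁻¹)
  have h : ∏ l, min (ν l + 1) 1 ≤ ‖∏ l, poch ((ν l : ℂ) + 1) m‖ := by
    rw [norm_prod]
    refine Finset.prod_le_prod (fun l _ => (lt_min (hpos l) one_pos).le) fun l _ => ?_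
    simpa using min_one_le_norm_poch (hpos l) m
  rw [hypergeometricCoeff, norm_inv, norm_mul, norm_natCast, mul_inv, mul_assoc, div_eq_mul_inv,
    mul_comm (|R| ^ m)]
  gcongr

/-- The factor `n (n - 1) ⋯ (n - m + 1) / n ^ m` that separates the coefficients of the rescaled
polynomials from those of the limit. -/
noncomputable def fallingRatio (n m : ℕ) : ℝ := (n.descFactorial m : ℝ) / (n : ℝ) ^ m

lemma fallingRatio_nonneg (n m : ℕ) : 0 ≤ fallingRatio n m := by
  unfold fallingRatio; positivity

lemma fallingRatio_le_one (n m : ℕ) : fallingRatio n m ≤ 1 :=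
  div_le_one_of_le₀ (by exact_mod_cast Nat.descFactorial_le_pow n m) (by positivity)

lemma fallingRatio_eq_zero {n m : ℕ} (h : n < m) : fallingRatio n m = 0 := by
  rw [fallingRatio, Nat.descFactorial_of_lt h, Nat.cast_zero, zero_div]

lemma tendsto_fallingRatio (m : ℕ) : Tendsto (fun n => fallingRatio n m) atTop (𝓝 1) := by
  induction m with
  | zero => simp [fallingRatio]
  | succ m ih =>
    have h : Tendsto (fun n : ℕ => (1 : ℝ) - (m : ℝ) / n) atTop (𝓝 1) := by
      simpa using tendsto_const_nhds.sub (tendsto_const_div_atTop_nhds_zero_nat (m : ℝ))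
    have h2 := h.mul ih
    rw [one_mul] at h2
    refine h2.congr' ?_
    filter_upwards [eventually_gt_atTop m] with n hn
    have hn0 : (n : ℝ) ≠ 0 := Nat.cast_ne_zero.2 (by omega)
    rw [fallingRatio, fallingRatio, Nat.descFactorial_succ, Nat.cast_mul, Nat.cast_sub hn.le]
    field_simp
    ring

lemma scaled_hypergeometricPoly_eq (hν : ∀ l, -1 < ν l) (n : ℕ) (z : ℂ) :
    (-1 : ℂ) ^ n * ((hypergeometricPoly ν n).eval (z / (n : ℂ)) / ∏ j, poch ((ν j : ℂ) + 1) n)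
      = ∑' m, (fallingRatio n m : ℂ) * (hypergeometricCoeff ν m * (-z) ^ m) := by
  have hA (m : ℕ) : ∏ j, poch ((ν j : ℂ) + 1) m ≠ 0 := fun h => by
    have := gammaMoment_eq hν m
    rw [h, zero_mul] at this
    exact gammaMoment_ne_zero hν m this
  rw [tsum_eq_sum (s := Finset.range (n + 1)) fun m hm => by
    rw [fallingRatio_eq_zero (by simpa using hm)]; simp]
  rw [Polynomial.eval_eq_sum_range, natDegree_hypergeometricPoly hν, Finset.sum_div,
    Finset.mul_sum]
  refine Finset.sum_congr rfl fun m hm => ?_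
  have h0 := gammaMoment_ne_zero hν 0
  have hm0 := hA m
  have hn0 := hA n
  have hf : (m.factorial : ℂ) ≠ 0 := Nat.cast_ne_zero.2 m.factorial_ne_zero
  have hs : (-1 : ℂ) ^ n * (-1) ^ (n + m) = (-1) ^ m := by
    rw [pow_add, ← mul_assoc, ← pow_add, ← two_mul, pow_mul]
    simp
  have hr : gammaMoment ν n / gammaMoment ν m
      = (∏ j, poch ((ν j : ℂ) + 1) n) / ∏ j, poch ((ν j : ℂ) + 1) m := by
    rw [gammaMoment_eq hν n, gammaMoment_eq hν m, mul_div_mul_right _ _ h0]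
  rw [coeff_hypergeometricPoly, hr, fallingRatio, hypergeometricCoeff, neg_pow z, ← hs,
    Nat.descFactorial_eq_factorial_mul_choose, div_pow]
  push_cast
  field_simp

lemma hypergeometric0F_eq (z : ℂ) :
    hypergeometric0F (fun j => (ν j : ℂ) + 1) (-z)
      = ∑' m, hypergeometricCoeff ν m * (-z) ^ m := by
  simp only [hypergeometric0F, hypergeometricCoeff, div_eq_mul_inv, mul_comm]

/-- On the disc of radius `R`, the difference of the two series is at most
`∑ₘ (1 - fallingRatio n m) * ‖hypergeometricCoeff ν m‖ * R ^ m`, which tends to `0` by Tannery's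
theorem. -/
lemma tendstoUniformlyOn_scaled_hypergeometricPoly (hν : ∀ l, -1 < ν l) {K : Set ℂ}
    (hK : IsCompact K) :
    TendstoUniformlyOn
      (fun (n : ℕ) (z : ℂ) =>
        (-1 : ℂ) ^ n * ((hypergeometricPoly ν n).eval (z / (n : ℂ)) /
          ∏ j, poch ((ν j : ℂ) + 1) n))
      (fun z : ℂ => hypergeometric0F (fun j => (ν j : ℂ) + 1) (-z)) atTop K := by
  obtain ⟨R, hR⟩ := hK.isBounded.exists_norm_le
  have hsum := summable_norm_hypergeometricCoeff hν R
  set t : ℕ → ℝ := fun m => ‖hypergeometricCoeff ν m‖ * |R| ^ m with ht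
  have ht0 (m : ℕ) : 0 ≤ t m := by positivity
  have hlim : Tendsto (fun n => ∑' m, (1 - fallingRatio n m) * t m) atTop (𝓝 0) := by
    have h := tendsto_tsum_of_dominated_convergence (𝓕 := atTop)
      (f := fun n m => (1 - fallingRatio n m) * t m) (g := fun _ => 0) hsum ?_ ?_
    · simpa using h
    · intro m
      simpa using ((tendsto_const_nhds (x := (1 : ℝ))).sub (tendsto_fallingRatio m)).mul_const (t m)
    · refine Eventually.of_forall fun n m => ?_
      rw [Real.norm_of_nonneg (mul_nonneg (by linarith [fallingRatio_le_one n m]) (ht0 m))]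
      exact mul_le_of_le_one_left (ht0 m) (by linarith [fallingRatio_nonneg n m])
  rw [Metric.tendstoUniformlyOn_iff]
  intro ε hε
  filter_upwards [hlim.eventually_lt_const hε] with n hn z hz
  refine lt_of_le_of_lt ?_ hn
  have hterm (m : ℕ) : ‖hypergeometricCoeff ν m * (-z) ^ m‖ ≤ t m := by
    rw [norm_mul, norm_pow, norm_neg]
    have := (hR z hz).trans (le_abs_self R)
    simp only [ht]
    gcongr
  have hterm' (m : ℕ) : ‖(fallingRatio n m : ℂ) * (hypergeometricCoeff ν m * (-z) ^ m)‖ ≤ t m := by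
    rw [norm_mul, norm_real, Real.norm_of_nonneg (fallingRatio_nonneg n m)]
    exact (mul_le_of_le_one_left (norm_nonneg _) (fallingRatio_le_one n m)).trans (hterm m)
  rw [scaled_hypergeometricPoly_eq hν, hypergeometric0F_eq, dist_eq_norm,
    ← (Summable.of_norm_bounded hsum hterm).tsum_sub (Summable.of_norm_bounded hsum hterm')]
  have hdiff (m : ℕ) : ‖hypergeometricCoeff ν m * (-z) ^ m
      - (fallingRatio n m : ℂ) * (hypergeometricCoeff ν m * (-z) ^ m)‖
      ≤ (1 - fallingRatio n m) * t m := by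
    rw [← one_sub_mul, norm_mul, ← ofReal_one, ← ofReal_sub, norm_real,
      Real.norm_of_nonneg (by linarith [fallingRatio_le_one n m])]
    exact mul_le_mul_of_nonneg_left (hterm m) (by linarith [fallingRatio_le_one n m])
  refine tsum_of_norm_bounded (Summable.hasSum ?_) hdiff
  refine Summable.of_nonneg_of_le (fun m => (norm_nonneg _).trans (hdiff m)) (fun m => ?_) hsum
  exact mul_le_of_le_one_left (ht0 m) (by linarith [fallingRatio_nonneg n m])

end

end MehlerHeine

theorem theorem7 {r : ℕ} [NeZero r] (ν : Fin r → ℝ) (hν : ∀ j, -1 < ν j)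
    (c : ℝ) (hc : ∀ j, -ν j < c) :
    (∀ n : ℕ, ∃! p : Polynomial ℂ, MehlerHeine.IsMultipleOrthogonal c ν n p) ∧
    ∀ P : ℕ → Polynomial ℂ, (∀ n, MehlerHeine.IsMultipleOrthogonal c ν n (P n)) →
      ∀ K : Set ℂ, IsCompact K →
        TendstoUniformlyOn
          (fun (n : ℕ) (z : ℂ) =>
            (-1 : ℂ) ^ n * ((P n).eval (z / (n : ℂ)) / ∏ j, MehlerHeine.poch ((ν j : ℂ) + 1) n))
          (fun z : ℂ => MehlerHeine.hypergeometric0F (fun j => (ν j : ℂ) + 1) (-z))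
          Filter.atTop K := by
  have hex := MehlerHeine.isMultipleOrthogonal_hypergeometricPoly hν hc
  refine ⟨fun n => ⟨_, hex n, fun q hq =>
    MehlerHeine.isMultipleOrthogonal_unique hν hc hq (hex n)⟩, fun P hP K hK => ?_⟩
  obtain rfl : P = fun n => MehlerHeine.hypergeometricPoly ν n :=
    funext fun n => MehlerHeine.isMultipleOrthogonal_unique hν hc (hP n) (hex n)
  exact MehlerHeine.tendstoUniformlyOn_scaled_hypergeometricPoly hν hK
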